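/- All polynomials are over the field $\mathbb{Q}$, and $\log n$ stands for $\lfloor \log_2 n\rfloor$ (with $\log 0 = 0$). Conventions. A straight-line program of size $r$ is a sequence of $r$ instructions, each of which adds, subtracts or multiplies two inputs or previously computed results; $L(f)$ is the least size of a straight-line program that computes $f$ from variables and constants in $\mathbb{Q}$. A function $t:\mathbb{N}\to\mathbb{N}$ is polynomially bounded if $t(n)\le n^{c}+c$ for some constant $c$ and all $n$, and quasi-polynomially bounded if $t(n)\le 2^{(\log n)^{c}+c}$ for some constant $c$ and all $n$. A $p$-family is a sequence $(f_n)_{n\ge 0}$ of polynomials $f_n\in\mathbb{Q}[x_1,\dots,x_{v(n)}]$ such that $v(n)$ and $\deg f_n$ are polynomially bounded. $\mathrm{VP}$ (resp. $\mathrm{VQP}$) is the class of $p$-families for which $L(f_n)$ is polynomially (resp. quasi-polynomially) bounded. $\mathrm{VNP}$ is the class of $p$-families $(f_n)$ for which there is a family $(g_n)\in\mathrm{VP}$, $g_n\in\mathbb{Q}[x_1,\dots,x_{u(n)}]$ with $u(n)\ge v(n)$, such that for all $n$ $$f_n(x_1,\dots,x_{v(n)})=\sum_{e\in\{0,1\}^{u(n)-v(n)}}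 g_n(x_1,\dots,x_{v(n)},e_{v(n)+1},\dots,e_{u(n)}).$$ For $v,t\in\mathbb{N}$ let $D_{v,t}\subseteq\mathbb{Q}[x_1,\dots,x_v]$ be the set of polynomials of the form $\sum_{e\in\{0,1\}^{u-v}} g(x_1,\dots,x_v,e)$ with $v\le u\le t$, $g\in\mathbb{Q}[x_1,\dots,x_u]$, $\deg g\le t$ and $L(g)\le t$; thus a $p$-family is in $\mathrm{VNP}$ iff $f_n\in D_{v(n),t(n)}$ for all $n$, for some polynomially bounded $t$. The closure $\overline{\mathrm{VNP}}$ is the class of $p$-families $(f_n)$ for which there is a polynomially bounded $t$ such that, for all $n$, $f_n$ lies in the Zariski closure of $D_{v(n),t(n)}$, i.e. every polynomial in the coefficients that vanishes on $D_{v(n),t(n)}$ also vanishes at $f_n$. Theorem. Let $$f_n:=\sum_{\mu\in\{0,\dots,n-1\}^{\log n}}2^{2^{j(\mu)}}X_1^{\mu_1}\cdots X_{\log n}^{\mu_{\log n}},\qquad j(\mu):=\sum_{j=1}^{\log n}\mu_j n^{j-1}.$$ Then $(f_n)\in\mathrm{VQP}$, but $(f_n)\notin\overline{\mathrm{VNP}}$.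 Hence $\mathrm{VQP}\not\subseteq\overline{\mathrm{VNP}}$. -/

import Mathlib

open MvPolynomial

noncomputable section

namespace AlgComplexity

/-! ### Growth conditions -/

/-- `t` is polynomially bounded. -/
def PBounded (t : ℕ → ℕ) : Prop :=
  ∃ c : ℕ, ∀ n, t n ≤ n ^ c + c

/-- `t` is quasi-polynomially bounded: `t n ≤ 2 ^ ((log n) ^ O(1))`, where the additive constant in
the exponent takes care of finitely many small `n`. -/
def QPBounded (t : ℕ → ℕ) : Prop :=
  ∃ c : ℕ, ∀ n, t n ≤ 2 ^ (Nat.log 2 n ^ c + c)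

/-! ### Straight-line programs -/

/-- The operation symbols of straight-line programs. -/
inductive Op : Type
  | add
  | sub
  | mul

/-- The meaning of an operation symbol in a commutative ring. -/
def Op.apply {R : Type*} [CommRing R] : Op → R → R → R
  | Op.add, a, b => a + b
  | Op.sub, a, b => a - b
  | Op.mul, a, b => a * b

/-- `SLP m r`: straight-line programs of size `r` that expect `m` inputs. Such a program is a
sequence of `r` instructions; each consists of an operation symbol and two addresses that point to
one of the `m` inputs or to the result of an earlier instruction. The inputs have the addresses
`0, …, m - 1`, and the results of the instructions have the addresses `m, m + 1, …`. -/
inductive SLP (m : ℕ) : ℕ → Type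
  | nil : SLP m 0
  | snoc {r : ℕ} (Γ : SLP m r) (op : Op) (i j : Fin (m + r)) : SLP m (r + 1)

/-- The sequence of the inputs followed by the results of all instructions. -/
def SLP.values {R : Type*} [CommRing R] {m : ℕ} (a : Fin m → R) :
    {r : ℕ} → SLP m r → Fin (m + r) → R
  | _, SLP.nil => a
  | _, SLP.snoc Γ op i j =>
      Fin.snoc (α := fun _ => R) (Γ.values a) (op.apply (Γ.values a i) (Γ.values a j))

/-- `f` is computed by a straight-line program of size `r` from variables and constants. -/
def ComputableInSize {F : Type*} [Field F] {v : ℕ} (f : MvPolynomial (Fin v) F) (r : ℕ) : Prop :=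
  ∃ (m : ℕ) (a : Fin m → MvPolynomial (Fin v) F) (Γ : SLP m r),
    (∀ k, (∃ i, a k = X i) ∨ ∃ c, a k = C c) ∧ ∃ k, Γ.values a k = f

/-- The complexity `L(f)`: the minimal size of a straight-line program that computes `f` from
variables and constants. -/
def complexity {F : Type*} [Field F] {v : ℕ} (f : MvPolynomial (Fin v) F) : ℕ∞ :=
  ⨅ (r : ℕ) (_ : ComputableInSize f r), (r : ℕ∞)

/-! ### The classes VP, VQP and VNP -/

/-- A sequence `f_0, f_1, f_2, …` of multivariate polynomials,
with `f_n ∈ F[x_1, …, x_{v(n)}]`. -/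
structure PolyFamily (F : Type*) [Field F] where
  /-- the number of variables of the `n`-th polynomial -/
  numVars : ℕ → ℕ
  /-- the `n`-th polynomial -/
  poly : (n : ℕ) → MvPolynomial (Fin (numVars n)) F

/-- A `p`-family: the number of variables and the degree are polynomially bounded. -/
def PolyFamily.IsPFamily {F : Type*} [Field F] (f : PolyFamily F) : Prop :=
  PBounded f.numVars ∧ PBounded fun n => (f.poly n).totalDegree

/-- The class VP of `p`-computable families. -/
def VP (F : Type*) [Field F] : Set (PolyFamily F) :=
  {f | f.IsPFamily ∧ ∃ t, PBounded t ∧ ∀ n, complexity (f.poly n) ≤ t n}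

/-- The class VQP of `qp`-computable families. -/
def VQP (F : Type*) [Field F] : Set (PolyFamily F) :=
  {f | f.IsPFamily ∧ ∃ t, QPBounded t ∧ ∀ n, complexity (f.poly n) ≤ t n}

/-- For `v ≤ u`, the polynomial `∑ e ∈ {0,1}^{u-v}, g(x_1, …, x_v, e_{v+1}, …, e_u)`. -/
def boolSum {F : Type*} [Field F] {u : ℕ} (v : ℕ) (g : MvPolynomial (Fin u) F) :
    MvPolynomial (Fin v) F :=
  ∑ e : Fin (u - v) → Fin 2,
    aeval (fun i : Fin u =>
      if h : (i : ℕ) < v then (X ⟨i, h⟩ : MvPolynomial (Fin v) F)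
      else C (((e ⟨i - v, by omega⟩ : Fin 2) : ℕ) : F)) g

/-- The class VNP of `p`-definable families. -/
def VNP (F : Type*) [Field F] : Set (PolyFamily F) :=
  {f | f.IsPFamily ∧ ∃ g ∈ VP F, ∀ n,
    f.numVars n ≤ g.numVars n ∧ f.poly n = boolSum (f.numVars n) (g.poly n)}

/-! ### The closure of VNP -/

/-- The polynomials in `v` variables that are definable within the resource bound `t`: they are
Boolean sums of a polynomial with at most `t` variables, degree at most `t` and complexity at
most `t`. -/
def definableWithin (F : Type*) [Field F] (v t : ℕ) : Set (MvPolynomial (Fin v) F) :=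
  {f | ∃ (u : ℕ) (g : MvPolynomial (Fin u) F), v ≤ u ∧ u ≤ t ∧ g.totalDegree ≤ t ∧
    complexity g ≤ t ∧ f = boolSum v g}

/-- The Zariski closure of a set of polynomials: all `f` whose coefficient vector is a zero of every
polynomial `H` in (finitely many of) the coefficients that vanishes on the whole set. -/
def zariskiClosure {F : Type*} [Field F] {v : ℕ} (S : Set (MvPolynomial (Fin v) F)) :
    Set (MvPolynomial (Fin v) F) :=
  {f | ∀ H : MvPolynomial (Fin v →₀ ℕ) F,
    (∀ g ∈ S, eval (fun μ => coeff μ g) H = 0) → eval (fun μ => coeff μ f) H = 0}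

/-- The closure of VNP: the `p`-families `f` such that, for some polynomially bounded `t`, every
`f_n` lies in the Zariski closure of the set of polynomials definable within the bound `t(n)`. -/
def VNPClosure (F : Type*) [Field F] : Set (PolyFamily F) :=
  {f | f.IsPFamily ∧ ∃ t, PBounded t ∧
    ∀ n, f.poly n ∈ zariskiClosure (definableWithin F (f.numVars n) (t n))}

theorem PBounded.mono {s t : ℕ → ℕ} (h : ∀ n, s n ≤ t n) (ht : PBounded t) : PBounded s := by
  obtain ⟨c, hc⟩ := ht
  exact ⟨c, fun n => (h n).trans (hc n)⟩

theorem PBounded.add {s t : ℕ → ℕ} (hs : PBounded s) (ht : PBounded t) :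
    PBounded fun n => s n + t n := by
  obtain ⟨c, hc⟩ := hs
  obtain ⟨d, hd⟩ := ht
  refine ⟨c + d + 2, fun n => ?_⟩
  have h1 := hc n
  have h2 := hd n
  rcases Nat.lt_or_ge n 2 with h | h
  · have e1 : n ^ c ≤ 1 := pow_le_one' (by omega) _
    have e2 : n ^ d ≤ 1 := pow_le_one' (by omega) _
    show s n + t n ≤ _
    omega
  · have e1 : n ^ c ≤ n ^ (c + d + 1) := Nat.pow_le_pow_right (by omega) (by omega)
    have e2 : n ^ d ≤ n ^ (c + d + 1) := Nat.pow_le_pow_right (by omega) (by omega)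
    have e3 : n ^ (c + d + 1) * 2 ≤ n ^ (c + d + 2) := by
      rw [pow_succ n (c + d + 1)]
      exact Nat.mul_le_mul_left _ h
    show s n + t n ≤ _
    omega

/-- VNP consists of the `p`-families that are definable within a polynomial bound; the class
`VNPClosure` is obtained from this by taking the Zariski closure for each `n`. -/
theorem mem_VNP_iff {F : Type*} [Field F] (f : PolyFamily F) :
    f ∈ VNP F ↔ f.IsPFamily ∧ ∃ t, PBounded t ∧
      ∀ n, f.poly n ∈ definableWithin F (f.numVars n) (t n) := by
  constructor
  · rintro ⟨hf, g, ⟨⟨hg1, hg2⟩, s, hs, hgs⟩, hfg⟩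
    refine ⟨hf, _, (hg1.add hg2).add hs, fun n => ?_⟩
    refine ⟨g.numVars n, g.poly n, (hfg n).1, by omega, by omega, (hgs n).trans ?_, (hfg n).2⟩
    exact_mod_cast Nat.le_add_left _ _
  · rintro ⟨hf, t, ht, h⟩
    choose u g h1 h2 h3 h4 h5 using h
    exact ⟨hf, ⟨u, g⟩, ⟨⟨ht.mono h2, ht.mono h3⟩, t, ht, h4⟩, fun n => ⟨h1 n, h5 n⟩⟩

/-! ### The separating family -/

/-- The family `f_n = ∑_{μ ∈ {0, …, n-1}^{log n}} 2^(2^{j(μ)}) X^μ` over `ℚ` with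
`j(μ) = ∑_{j=1}^{log n} μ_j n^{j-1}`, where `log n` stands for `⌊log₂ n⌋`
(`Fin` counts from zero, so `n^{j-1}` is `n ^ (i : ℕ)`). -/
def doubleExpFamily : PolyFamily ℚ where
  numVars n := Nat.log 2 n
  poly n := ∑ μ : Fin (Nat.log 2 n) → Fin n,
    C ((2 : ℚ) ^ (2 ^ (∑ i, (μ i : ℕ) * n ^ (i : ℕ)) : ℕ)) * ∏ i, X i ^ (μ i : ℕ)

end AlgComplexity

end

/-! Membership in VQP is brute force: `f_n` has only `n ^ log n` terms, and its huge coefficients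
are constants, which cost nothing.

The lower bound is a counting argument. Up to the choice of `u ≤ t`, every polynomial definable
within `t` is a specialisation of one universal Boolean sum, whose coefficients are integer
polynomials in only `M = 8(t+1)²` parameters (`exists_aeval_universalCoeff_eq`), of degree at most
exponential and norm at most doubly exponential in `t`. Take the `K = n ^ log n` monomials of `f_n`.
There are `2^(2^K)` multilinear polynomials with coefficients 0 and 1 in the corresponding `K`
coefficients, but substituting the universal coefficients leaves fewer possible results once `K >
(M+1)(log K + 3t + 5)`. So two of them agree after substitution
(`exists_ne_sum_prod_universalCoeff_eq`), and their difference vanishes on the definable set and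
hence on its Zariski closure.

It cannot vanish at `f_n`: the coefficients `2^(2^j)` with distinct `j` satisfy no nontrivial
multilinear equation with coefficients in `{-1, 0, 1}`, by uniqueness of binary expansions applied
twice (`injective_sum_prod_two_pow_two_pow`). For polynomially bounded `t` a suitable power of two
`n` makes `K` large enough (`PBounded.exists_lt_pow_log`). -/

noncomputable section

namespace AlgComplexity

/-! ### Upper bounds for the complexity -/

/-- Every straight-line program with inputs `a` can be extended by `r` instructions to one that also
computes `f`. -/
def Cost {R : Type*} [CommRing R] {m : ℕ} (a : Fin m → R) (f : R) (r : ℕ) : Prop :=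
  ∀ (r₀ : ℕ) (Γ : SLP m r₀), ∃ Γ' : SLP m (r₀ + r),
    Set.range (Γ.values a) ⊆ Set.range (Γ'.values a) ∧ f ∈ Set.range (Γ'.values a)

theorem SLP.range_values_snoc {R : Type*} [CommRing R] {m r : ℕ} (a : Fin m → R) (Γ : SLP m r)
    (op : Op) (i j : Fin (m + r)) :
    Set.range ((Γ.snoc op i j).values a) =
      insert (op.apply (Γ.values a i) (Γ.values a j)) (Set.range (Γ.values a)) := by
  ext y
  simp only [Set.mem_range, Set.mem_insert_iff]
  constructor
  · rintro ⟨k, rfl⟩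
    refine Fin.lastCases (n := m + r) ?_ (fun k => ?_) k
    · left
      exact Fin.snoc_last (α := fun _ => R) _ _
    · right
      exact ⟨k, (Fin.snoc_castSucc (α := fun _ => R) _ _ k).symm⟩
  · rintro (rfl | ⟨k, rfl⟩)
    · exact ⟨Fin.last (m + r), Fin.snoc_last (α := fun _ => R) _ _⟩
    · exact ⟨Fin.castSucc k, Fin.snoc_castSucc (α := fun _ => R) _ _ k⟩

theorem SLP.range_subset_range_values {R : Type*} [CommRing R] {m r : ℕ} (a : Fin m → R)
    (Γ : SLP m r) : Set.range a ⊆ Set.range (Γ.values a) := by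
  induction Γ with
  | nil => exact subset_rfl
  | snoc Γ op i j ih =>
    rw [SLP.range_values_snoc]
    exact ih.trans (Set.subset_insert _ _)

namespace Cost

variable {R : Type*} [CommRing R] {m : ℕ} {a : Fin m → R}

theorem input {f : R} (hf : f ∈ Set.range a) : Cost a f 0 :=
  fun _ Γ => ⟨Γ, subset_rfl, Γ.range_subset_range_values a hf⟩

/-- This is why `Cost` quantifies over the starting program: `g` is computed by extending the
program that already holds `f`, so costs simply add. -/
theorem op {f g : R} {r s : ℕ} (hf : Cost a f r) (hg : Cost a g s) (o : Op) :
    Cost a (o.apply f g) (r + s + 1) := by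
  intro r₀ Γ
  obtain ⟨Γ₁, h₁, hf₁⟩ := hf r₀ Γ
  obtain ⟨Γ₂, h₂, j, hj⟩ := hg _ Γ₁
  obtain ⟨i, hi⟩ := h₂ hf₁
  rw [show r₀ + (r + s + 1) = r₀ + r + s + 1 by ring]
  refine ⟨Γ₂.snoc o i j, ?_⟩
  rw [SLP.range_values_snoc, hi, hj]
  exact ⟨(h₁.trans h₂).trans (Set.subset_insert _ _), Set.mem_insert _ _⟩

theorem mul {f g : R} {r s : ℕ} (hf : Cost a f r) (hg : Cost a g s) :
    Cost a (f * g) (r + s + 1) := hf.op hg Op.mul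

theorem add {f g : R} {r s : ℕ} (hf : Cost a f r) (hg : Cost a g s) :
    Cost a (f + g) (r + s + 1) := hf.op hg Op.add

theorem pow (h1 : (1 : R) ∈ Set.range a) {f : R} (hf : f ∈ Set.range a) (k : ℕ) :
    Cost a (f ^ k) k := by
  induction k with
  | zero => simpa using input h1
  | succ k ih => simpa [pow_succ] using ih.mul (input hf)

theorem sum {ι : Type*} (h0 : (0 : R) ∈ Set.range a) (s : Finset ι) {f : ι → R} {r : ι → ℕ}
    (hf : ∀ i ∈ s, Cost a (f i) (r i)) : Cost a (∑ i ∈ s, f i) (∑ i ∈ s, (r i + 1)) := by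
  classical
  induction s using Finset.induction_on with
  | empty => simpa using input h0
  | insert i s hi ih =>
    rw [Finset.sum_insert hi, Finset.sum_insert hi]
    convert (hf i (Finset.mem_insert_self i s)).add
      (ih fun j hj => hf j (Finset.mem_insert_of_mem hj)) using 1
    ring

theorem prod {ι : Type*} (h1 : (1 : R) ∈ Set.range a) (s : Finset ι) {f : ι → R} {r : ι → ℕ}
    (hf : ∀ i ∈ s, Cost a (f i) (r i)) : Cost a (∏ i ∈ s, f i) (∑ i ∈ s, (r i + 1)) := by
  classical
  induction s using Finset.induction_on with
  | empty => simpa using input h1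
  | insert i s hi ih =>
    rw [Finset.prod_insert hi, Finset.sum_insert hi]
    convert (hf i (Finset.mem_insert_self i s)).mul
      (ih fun j hj => hf j (Finset.mem_insert_of_mem hj)) using 1
    ring

theorem complexity_le {F : Type*} [Field F] {v : ℕ} {a : Fin m → MvPolynomial (Fin v) F}
    (ha : ∀ k, (∃ i, a k = X i) ∨ ∃ c, a k = C c) {f : MvPolynomial (Fin v) F} {r : ℕ}
    (hf : Cost a f r) : complexity f ≤ r := by
  have h := hf 0 SLP.nil
  rw [zero_add] at h
  obtain ⟨Γ, -, hΓ⟩ := h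
  exact iInf₂_le r ⟨m, a, Γ, ha, hΓ⟩

end Cost

/-- The trivial bound for the complexity of a polynomial given as a sum of terms. -/
theorem complexity_sum_terms_le {F : Type*} [Field F] {v : ℕ} {ι : Type*} [Fintype ι]
    (c : ι → F) (e : ι → Fin v → ℕ) (d : ℕ) (he : ∀ μ i, e μ i ≤ d) :
    complexity (∑ μ, C (c μ) * ∏ i, X i ^ e μ i : MvPolynomial (Fin v) F) ≤
      (Fintype.card ι * (v * (d + 1) + 2) : ℕ) := by
  let b : Fin v ⊕ ι ⊕ Bool → MvPolynomial (Fin v) F :=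
    Sum.elim X (Sum.elim (fun μ => C (c μ)) fun s => if s then 1 else 0)
  let a := b ∘ (Fintype.equivFin (Fin v ⊕ ι ⊕ Bool)).symm
  have hab : Set.range a = Set.range b := (Fintype.equivFin _).symm.surjective.range_comp b
  have h0 : (0 : MvPolynomial (Fin v) F) ∈ Set.range a := hab ▸ ⟨.inr (.inr false), by simp [b]⟩
  have h1 : (1 : MvPolynomial (Fin v) F) ∈ Set.range a := hab ▸ ⟨.inr (.inr true), by simp [b]⟩
  have hX (i : Fin v) : X i ∈ Set.range a := hab ▸ ⟨.inl i, rfl⟩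
  have hC (μ : ι) : C (c μ) ∈ Set.range a := hab ▸ ⟨.inr (.inl μ), rfl⟩
  have hb : ∀ k, (∃ i, b k = X i) ∨ ∃ x, b k = C x := by
    rintro (i | μ | s)
    · exact .inl ⟨i, rfl⟩
    · exact .inr ⟨c μ, rfl⟩
    · cases s
      · exact .inr ⟨0, by simp [b]⟩
      · exact .inr ⟨1, by simp [b]⟩
  have key := Cost.sum h0 Finset.univ fun μ _ => (Cost.input (hC μ)).mul
    (Cost.prod h1 Finset.univ fun i _ => Cost.pow h1 (hX i) (e μ i))
  refine (key.complexity_le fun k => hb _).trans (Nat.cast_le.2 ?_)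
  -- Per term: `v * (d + 1)` for the monomial, one multiplication by the coefficient and one
  -- addition to the running sum.
  refine (Finset.sum_le_card_nsmul _ _ (v * (d + 1) + 2) fun μ _ => ?_).trans (by simp)
  have := Finset.sum_le_card_nsmul Finset.univ (fun i => e μ i + 1) (d + 1)
    fun i _ => Nat.succ_le_succ (he μ i)
  simp only [Finset.card_univ, Fintype.card_fin, smul_eq_mul] at this
  omega

theorem totalDegree_sum_terms_le {F : Type*} [Field F] {v : ℕ} {ι : Type*} [Fintype ι]
    (c : ι → F) (e : ι → Fin v → ℕ) (d : ℕ) (he : ∀ μ i, e μ i ≤ d) :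
    (∑ μ, C (c μ) * ∏ i, X i ^ e μ i : MvPolynomial (Fin v) F).totalDegree ≤ v * d := by
  refine totalDegree_finsetSum_le fun μ _ => (totalDegree_mul _ _).trans ?_
  rw [totalDegree_C, zero_add]
  refine (totalDegree_finsetProd _ _).trans ?_
  refine (Finset.sum_le_card_nsmul _ _ d fun i _ => ?_).trans (by simp)
  refine (totalDegree_pow _ _).trans ?_
  rw [totalDegree_X, mul_one]
  exact he μ i

/-! ### Membership of the separating family in VQP -/

theorem doubleExpFamily_isPFamily : doubleExpFamily.IsPFamily := by
  refine ⟨⟨1, fun n => ?_⟩, ⟨2, fun n => ?_⟩⟩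
  · have := Nat.log_le_self 2 n
    change Nat.log 2 n ≤ _
    rw [pow_one]
    omega
  · refine (totalDegree_sum_terms_le (v := Nat.log 2 n) (ι := Fin (Nat.log 2 n) → Fin n)
      (fun μ => (2 : ℚ) ^ (2 ^ (∑ i, (μ i : ℕ) * n ^ (i : ℕ)) : ℕ)) (fun μ i => (μ i : ℕ)) n
      fun μ i => (μ i).2.le).trans ?_
    have := Nat.mul_le_mul_right n (Nat.log_le_self 2 n)
    rw [sq]
    omega

theorem doubleExpFamily_mem_VQP : doubleExpFamily ∈ VQP ℚ := by
  refine ⟨doubleExpFamily_isPFamily,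
    fun n => n ^ Nat.log 2 n * (Nat.log 2 n * (n + 1) + 2), ⟨20, fun n => ?_⟩, fun n => ?_⟩
  · set v := Nat.log 2 n with hv
    have hn : n + 1 ≤ 2 ^ (v + 1) := Nat.lt_pow_succ_log_self (by norm_num) n
    have h1 : n ^ v ≤ 2 ^ ((v + 1) * v) := by
      rw [pow_mul]
      exact Nat.pow_le_pow_left (by omega) v
    have h2 : v * (n + 1) + 2 ≤ 2 ^ (2 * v + 2) := by
      have h3 : v + 1 ≤ 2 ^ v := Nat.lt_two_pow_self
      calc v * (n + 1) + 2 ≤ (v + 1) * 2 ^ (v + 1) := by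
            have : 2 ≤ 2 ^ (v + 1) := by
              rw [pow_succ]; have := Nat.one_le_two_pow (n := v); omega
            nlinarith
        _ ≤ 2 ^ v * 2 ^ (v + 1) := Nat.mul_le_mul_right _ h3
        _ ≤ 2 ^ (2 * v + 2) := by
            rw [← pow_add]
            exact Nat.pow_le_pow_right (by norm_num) (by omega)
    refine (Nat.mul_le_mul h1 h2).trans ?_
    rw [← pow_add]
    refine Nat.pow_le_pow_right (by norm_num) ?_
    -- A cubic exponent suffices; 20 also has to serve as the additive constant.
    have h4 : v ^ 3 ≤ v ^ 20 := by
      rcases Nat.eq_zero_or_pos v with h | h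
      · simp [h]
      · exact Nat.pow_le_pow_right h (by norm_num)
    have h5 : (v + 1) * v + (2 * v + 2) ≤ v ^ 3 + 20 := by
      rcases Nat.lt_or_ge v 3 with h | h
      · interval_cases v <;> norm_num
      · have : 3 * (v * v) ≤ v ^ 3 := by
          rw [pow_succ, sq, mul_comm]; exact Nat.mul_le_mul_left _ h
        nlinarith
    omega
  · have := complexity_sum_terms_le (v := Nat.log 2 n) (ι := Fin (Nat.log 2 n) → Fin n)
      (fun μ => (2 : ℚ) ^ (2 ^ (∑ i, (μ i : ℕ) * n ^ (i : ℕ)) : ℕ)) (fun μ i => (μ i : ℕ)) n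
      fun μ i => (μ i).2.le
    rwa [Fintype.card_fun, Fintype.card_fin, Fintype.card_fin] at this

/-! ### A universal circuit -/

theorem exists_computableInSize_of_complexity_le {F : Type*} [Field F] {v t : ℕ}
    {f : MvPolynomial (Fin v) F} (h : complexity f ≤ t) : ∃ r ≤ t, ComputableInSize f r := by
  by_contra! hr
  have : ((t + 1 : ℕ) : ℕ∞) ≤ complexity f :=
    le_iInf₂ fun r hf => Nat.cast_le.2 (not_le.1 fun hrt => hr r hrt hf)
  exact absurd (Nat.cast_le.1 (this.trans h)) (by omega)

/-! ### Straight-line programs as chains of products -/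

/-- The span of the elements of `B` and of the first `k` terms of the sequence `h`. -/
def spanBefore (F : Type*) {A : Type*} [Field F] [CommRing A] [Algebra F A] (B : Set A)
    (h : ℕ → A) (k : ℕ) : Submodule F A :=
  Submodule.span F (B ∪ h '' Set.Iio k)

section

variable {F A : Type*} [Field F] [CommRing A] [Algebra F A] {B : Set A}

theorem spanBefore_congr {h h' : ℕ → A} {k : ℕ} (hh : ∀ i < k, h i = h' i) :
    spanBefore F B h k = spanBefore F B h' k := by
  unfold spanBefore
  rw [Set.image_congr (s := Set.Iio k) fun i hi => hh i hi]

theorem spanBefore_mono {h : ℕ → A} {k l : ℕ} (hkl : k ≤ l) :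
    spanBefore F B h k ≤ spanBefore F B h l :=
  Submodule.span_mono (Set.union_subset_union_right _ (Set.image_mono (Set.Iio_subset_Iio hkl)))

theorem apply_mem_spanBefore {h : ℕ → A} {k l : ℕ} (hkl : k < l) : h k ∈ spanBefore F B h l :=
  Submodule.subset_span (.inr ⟨k, hkl, rfl⟩)

theorem subset_spanBefore {h : ℕ → A} {k : ℕ} : B ⊆ spanBefore F B h k :=
  Set.subset_union_left.trans Submodule.subset_span

/-- A sequence every term of which is a product of two linear combinations of elements of `B` and
of earlier terms. -/
def IsProductChain (F : Type*) {A : Type*} [Field F] [CommRing A] [Algebra F A] (B : Set A)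
    (h : ℕ → A) : Prop :=
  ∀ k, ∃ l ∈ spanBefore F B h k, ∃ l' ∈ spanBefore F B h k, h k = l * l'

theorem IsProductChain.update {h : ℕ → A} (hh : IsProductChain F B h) {r : ℕ}
    (hr : ∀ k, r < k → h k = 0) {l l' : A} (hl : l ∈ spanBefore F B h r)
    (hl' : l' ∈ spanBefore F B h r) : IsProductChain F B (Function.update h r (l * l')) := by
  intro k
  have hc : ∀ j ≤ r, spanBefore F B (Function.update h r (l * l')) j = spanBefore F B h j :=
    fun j hj => spanBefore_congr fun i hi => Function.update_of_ne (by omega) _ _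
  rcases lt_trichotomy k r with hk | rfl | hk
  · rw [hc k hk.le, Function.update_of_ne hk.ne]
    exact hh k
  · rw [hc k le_rfl, Function.update_self]
    exact ⟨l, hl, l', hl', rfl⟩
  · rw [Function.update_of_ne hk.ne', hr k hk]
    exact ⟨0, zero_mem _, 0, zero_mem _, (zero_mul 0).symm⟩

/-- Additions and subtractions are absorbed into linear combinations; to keep one term per
instruction, their results are entered as products with `1`. The zero tail lets
`IsProductChain.update` append the next term. -/
theorem SLP.exists_isProductChain (h1 : (1 : A) ∈ B) {m r : ℕ} {a : Fin m → A}
    (ha : ∀ i, a i ∈ Submodule.span F B) (Γ : SLP m r) :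
    ∃ h : ℕ → A, IsProductChain F B h ∧ (∀ k, r ≤ k → h k = 0) ∧
      ∀ i, Γ.values a i ∈ spanBefore F B h r := by
  induction Γ with
  | nil =>
    refine ⟨0, fun k => ⟨0, zero_mem _, 0, zero_mem _, (zero_mul 0).symm⟩, fun _ _ => rfl,
      fun i => ?_⟩
    exact Submodule.span_mono Set.subset_union_left (ha i)
  | @snoc r Γ op i j ih =>
    obtain ⟨h, hh, hr, hv⟩ := ih
    obtain ⟨l, hl, l', hl', he⟩ : ∃ l ∈ spanBefore F B h r, ∃ l' ∈ spanBefore F B h r,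
        op.apply (Γ.values a i) (Γ.values a j) = l * l' := by
      cases op
      · exact ⟨_, add_mem (hv i) (hv j), 1, subset_spanBefore h1, (mul_one _).symm⟩
      · exact ⟨_, sub_mem (hv i) (hv j), 1, subset_spanBefore h1, (mul_one _).symm⟩
      · exact ⟨_, hv i, _, hv j, rfl⟩
    refine ⟨Function.update h r (l * l'), hh.update (fun k hk => hr k hk.le) hl hl',
      fun k hk => ?_, fun k => ?_⟩
    · rw [Function.update_of_ne (by omega)]
      exact hr k (by omega)
    · have hk : (Γ.snoc op i j).values a k ∈ Set.range ((Γ.snoc op i j).values a) := ⟨k, rfl⟩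
      rw [SLP.range_values_snoc, he] at hk
      rcases hk with hk | ⟨k', hk⟩
      · rw [hk]
        have := apply_mem_spanBefore (F := F) (B := B) (h := Function.update h r (l * l'))
          (Nat.lt_succ_self r)
        rwa [Function.update_self] at this
      · rw [← hk]
        refine spanBefore_mono (Nat.le_succ r) ?_
        rw [spanBefore_congr (h' := h) fun i hi => Function.update_of_ne (by omega) _ _]
        exact hv k'

/-- A computable polynomial is the last term of a product chain over the variables and `1`. -/
theorem ComputableInSize.exists_isProductChain {v r t : ℕ} (hrt : r ≤ t)
    {f : MvPolynomial (Fin v) F} (hf : ComputableInSize f r) :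
    ∃ h : ℕ → MvPolynomial (Fin v) F, IsProductChain F (insert 1 (Set.range X)) h ∧ h t = f := by
  obtain ⟨m, a, Γ, ha, i, rfl⟩ := hf
  have h1 : (1 : MvPolynomial (Fin v) F) ∈ insert 1 (Set.range X) := Set.mem_insert _ _
  obtain ⟨h, hh, hr, hv⟩ := Γ.exists_isProductChain (F := F) h1 (a := a) fun i => by
    rcases ha i with ⟨j, hj⟩ | ⟨c, hc⟩
    · rw [hj]
      exact Submodule.subset_span (.inr ⟨j, rfl⟩)
    · rw [hc, ← mul_one (C c), ← smul_eq_C_mul]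
      exact Submodule.smul_mem _ _ (Submodule.subset_span h1)
  -- The zeros pad the chain from `r` to `t`. The value, a priori only a linear combination of
  -- terms, becomes a term itself after multiplication by `1`.
  refine ⟨Function.update h t (Γ.values a i * 1), hh.update (fun k hk => hr k (by omega))
    (spanBefore_mono hrt (hv i)) (subset_spanBefore h1), ?_⟩
  rw [Function.update_self, mul_one]

end

/-! ### Layers with shared parameters -/

/-- The nodes of a layer of the universal circuit: the constant `1`, `t` inputs and `t + 1`
results. -/
abbrev Node (t : ℕ) : Type := Option (Fin t) ⊕ Fin (t + 1)

/-- The parameters of the universal circuit: two linear forms for each node. -/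
abbrev Param (t : ℕ) : Type := Bool × Node t × Node t

/-- The initial layer of the universal circuit. -/
def initialLayer {A : Type*} [CommRing A] {t : ℕ} (x : Fin t → A) : Node t → A :=
  Sum.elim (fun o => o.elim 1 x) 0

/-- The layers of the universal circuit: each node is the product of two linear forms in the nodes
of the preceding layer; the coefficients of the linear forms are the parameters and do not depend on
the layer. -/
def layer {A : Type*} [CommRing A] {t : ℕ} (p : Param t → A) (x : Fin t → A) : ℕ → Node t → A
  | 0 => initialLayer x
  | n + 1 => fun i => (∑ j, p (false, i, j) * layer p x n j) * ∑ j, p (true, i, j) * layer p x n j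

/-- The output of the universal circuit. -/
def universal {A : Type*} [CommRing A] {t : ℕ} (p : Param t → A) (x : Fin t → A) : A :=
  layer p x (t + 1) (.inr (Fin.last t))

theorem map_initialLayer {A A' : Type*} [CommRing A] [CommRing A'] (φ : A →+* A') {t : ℕ}
    (x : Fin t → A) (i : Node t) : φ (initialLayer x i) = initialLayer (φ ∘ x) i := by
  rcases i with (_ | i) | i <;> simp [initialLayer]

theorem map_layer {A A' : Type*} [CommRing A] [CommRing A'] (φ : A →+* A') {t : ℕ}
    (p : Param t → A) (x : Fin t → A) (n : ℕ) (i : Node t) :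
    φ (layer p x n i) = layer (φ ∘ p) (φ ∘ x) n i := by
  induction n generalizing i with
  | zero => exact map_initialLayer φ x i
  | succ n ih => simp [layer, ih]

theorem map_universal {A A' : Type*} [CommRing A] [CommRing A'] (φ : A →+* A') {t : ℕ}
    (p : Param t → A) (x : Fin t → A) :
    φ (universal p x) = universal (φ ∘ p) (φ ∘ x) :=
  map_layer φ p x _ _

/-- The nodes of the universal circuit that hold the final values for the first `k` results. -/
def Node.Before {t : ℕ} (k : ℕ) : Node t → Prop
  | .inl _ => True
  | .inr i => (i : ℕ) < k

section

variable {F A : Type*} [Field F] [CommRing A] [Algebra F A] {t : ℕ}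

/-- The base elements and the terms of a sequence, arranged as a layer of the universal circuit. -/
def finalLayer (x : Fin t → A) (h : ℕ → A) : Node t → A :=
  Sum.elim (fun o => o.elim 1 x) fun i => h i

/-- The vanishing of `α` matters as much as the value: the form never reads a node whose value is
not yet final. -/
theorem exists_linear_form {x : Fin t → A} {h : ℕ → A} {k : ℕ} (hk : k ≤ t + 1) {l : A}
    (hl : l ∈ spanBefore F (insert 1 (Set.range x)) h k) :
    ∃ α : Node t → F, (∀ i, ¬ i.Before k → α i = 0) ∧
      ∑ i, algebraMap F A (α i) * finalLayer x h i = l := by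
  classical
  have single (i : Node t) (hi : i.Before k) : ∃ α : Node t → F, (∀ i, ¬ i.Before k → α i = 0) ∧
      ∑ j, algebraMap F A (α j) * finalLayer x h j = finalLayer x h i := by
    refine ⟨Pi.single i 1, fun j hj => Pi.single_eq_of_ne (by rintro rfl; exact hj hi) _, ?_⟩
    rw [Finset.sum_eq_single i (fun j _ hj => by simp [Pi.single_eq_of_ne hj]) (by simp)]
    simp
  induction hl using Submodule.span_induction with
  | mem y hy =>
    rcases hy with (rfl | ⟨i, rfl⟩) | ⟨i, hi, rfl⟩
    · exact single (.inl none) trivial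
    · exact single (.inl (some i)) trivial
    · exact single (.inr ⟨i, lt_of_lt_of_le hi hk⟩) hi
  | zero => exact ⟨0, fun _ _ => rfl, by simp⟩
  | add y z _ _ hy hz =>
    obtain ⟨α, hα, rfl⟩ := hy
    obtain ⟨β, hβ, rfl⟩ := hz
    exact ⟨α + β, fun i hi => by simp [hα i hi, hβ i hi],
      by simp [add_mul, Finset.sum_add_distrib]⟩
  | smul c y _ hy =>
    obtain ⟨α, hα, rfl⟩ := hy
    exact ⟨c • α, fun i hi => by simp [hα i hi],
      by
        rw [Finset.smul_sum]
        exact Finset.sum_congr rfl fun i _ => by simp [Algebra.smul_def, mul_assoc]⟩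

/-- Every product chain of length `t + 1` is computed by the universal circuit. -/
theorem IsProductChain.exists_universal_eq {x : Fin t → A} {h : ℕ → A}
    (hh : IsProductChain F (insert 1 (Set.range x)) h) :
    ∃ p : Param t → F, universal (algebraMap F A ∘ p) x = h t := by
  have node (i : Node t) : ∃ α β : Node t → F,
      (∀ k, i.Before (k + 1) → ∀ j, ¬ j.Before k → α j = 0 ∧ β j = 0) ∧
      (∑ j, algebraMap F A (α j) * finalLayer x h j) *
        (∑ j, algebraMap F A (β j) * finalLayer x h j) = finalLayer x h i := by
    rcases i with i | i
    · have hl : finalLayer x h (.inl i) ∈ spanBefore F (insert 1 (Set.range x)) h 0 := by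
        refine subset_spanBefore ?_
        rcases i with _ | i
        · exact .inl rfl
        · exact .inr ⟨i, rfl⟩
      -- A base node is recreated in every layer as itself times `1`.
      obtain ⟨α, hα, hα'⟩ := exists_linear_form (Nat.zero_le _) hl
      obtain ⟨β, hβ, hβ'⟩ := exists_linear_form (F := F) (x := x) (h := h) (k := 0)
        (Nat.zero_le _) (subset_spanBefore (.inl rfl : (1 : A) ∈ insert 1 (Set.range x)))
      have h0 (k : ℕ) (j : Node t) (hj : ¬ j.Before k) : ¬ j.Before 0 := by
        rcases j with j | j
        · exact hj
        · exact Nat.not_lt_zero _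
      refine ⟨α, β, fun k _ j hj => ⟨hα j (h0 k j hj), hβ j (h0 k j hj)⟩, ?_⟩
      rw [hα', hβ', mul_one]
    · obtain ⟨l, hl, l', hl', he⟩ := hh i
      obtain ⟨α, hα, hα'⟩ := exists_linear_form i.2.le hl
      obtain ⟨β, hβ, hβ'⟩ := exists_linear_form i.2.le hl'
      have h0 (k : ℕ) (hk : (i : ℕ) < k + 1) (j : Node t) (hj : ¬ j.Before k) : ¬ j.Before i := by
        rcases j with j | j
        · exact hj
        · change ¬ (j : ℕ) < i
          change ¬ (j : ℕ) < k at hj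
          omega
      refine ⟨α, β, fun k hk j hj => ⟨hα j (h0 k hk j hj), hβ j (h0 k hk j hj)⟩, ?_⟩
      rw [hα', hβ']
      exact he.symm
  choose α β hαβ hprod using node
  refine ⟨fun q => if q.1 then β q.2.1 q.2.2 else α q.2.1 q.2.2, ?_⟩
  -- The final values are a fixed point of the layer map, so one parameter set serves all layers:
  -- layer `n` has the first `n` results right, and the possibly wrong nodes get coefficient zero
  -- where they would matter.
  have key (n : ℕ) (i : Node t) (hi : i.Before n) :
      layer (algebraMap F A ∘ fun q : Param t => if q.1 then β q.2.1 q.2.2 else α q.2.1 q.2.2)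
        x n i = finalLayer x h i := by
    induction n generalizing i with
    | zero =>
      rcases i with i | i
      · rfl
      · exact absurd hi (Nat.not_lt_zero _)
    | succ n ih =>
      rw [← hprod i]
      simp only [layer, Function.comp, if_true, Bool.false_eq_true, if_false]
      congr 1
      · refine Finset.sum_congr rfl fun j _ => ?_
        by_cases hj : j.Before n
        · rw [← ih j hj]
        · simp [(hαβ i n hi j hj).1]
      · refine Finset.sum_congr rfl fun j _ => ?_
        by_cases hj : j.Before n
        · rw [← ih j hj]
        · simp [(hαβ i n hi j hj).2]
  exact key (t + 1) (.inr (Fin.last t)) (Nat.lt_succ_self t)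

end

/-! ### Boolean sums of the universal circuit -/

/-- The inputs `x₁, …, xᵤ, 0, …, 0` of the universal circuit, where `x₁, …, xᵥ` are variables and
the remaining ones are given by a point of the Boolean cube. -/
def boolInput (R : Type*) [CommRing R] (v t : ℕ) {u : ℕ} (e : Fin (u - v) → Fin 2) (i : Fin t) :
    MvPolynomial (Fin v) R :=
  if h : (i : ℕ) < v then X ⟨i, h⟩
  else if h' : (i : ℕ) < u then C (((e ⟨i - v, by omega⟩ : Fin 2) : ℕ) : R) else 0

/-- The Boolean sum of the universal polynomial in `u` variables. -/
def universalSum {R : Type*} [CommRing R] (v u : ℕ) {t : ℕ} (p : Param t → R) :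
    MvPolynomial (Fin v) R :=
  ∑ e : Fin (u - v) → Fin 2, universal (C ∘ p) (boolInput R v t e)

theorem map_universalSum {R R' : Type*} [CommRing R] [CommRing R'] (φ : R →+* R') (v u : ℕ) {t : ℕ}
    (p : Param t → R) : map φ (universalSum v u p) = universalSum v u (φ ∘ p) := by
  unfold universalSum
  rw [map_sum]
  refine Finset.sum_congr rfl fun e _ => ?_
  rw [map_universal]
  congr 1
  · ext1 q
    simp
  · ext1 i
    simp only [Function.comp, boolInput]
    split_ifs <;> simp

theorem exists_universalSum_eq {F : Type*} [Field F] {v t : ℕ} {f : MvPolynomial (Fin v) F}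
    (hf : f ∈ definableWithin F v t) :
    ∃ u ≤ t, ∃ p : Param t → F, universalSum v u p = f := by
  obtain ⟨u, g, hvu, hut, -, hg, rfl⟩ := hf
  obtain ⟨r, hr, hgr⟩ := exists_computableInSize_of_complexity_le hg
  obtain ⟨h, hh, rfl⟩ := hgr.exists_isProductChain hr
  -- The circuit always has `t` inputs; the surplus ones are set to zero.
  let x : Fin t → MvPolynomial (Fin u) F := fun i => if hi : (i : ℕ) < u then X ⟨i, hi⟩ else 0
  have hsub : (insert 1 (Set.range X) : Set (MvPolynomial (Fin u) F)) ⊆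
      insert 1 (Set.range x) := by
    refine Set.insert_subset_insert ?_
    rintro _ ⟨i, rfl⟩
    exact ⟨⟨i, lt_of_lt_of_le i.2 hut⟩, by simp [x]⟩
  have hh' : IsProductChain F (insert 1 (Set.range x)) h := fun k => by
    have hmono : spanBefore F (insert 1 (Set.range X)) h k ≤
        spanBefore F (insert 1 (Set.range x)) h k :=
      Submodule.span_mono (Set.union_subset_union_left _ hsub)
    obtain ⟨l, hl, l', hl', he⟩ := hh k
    exact ⟨l, hmono hl, l', hmono hl', he⟩
  obtain ⟨p, hp⟩ := hh'.exists_universal_eq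
  refine ⟨u, hut, p, ?_⟩
  unfold universalSum boolSum
  refine Finset.sum_congr rfl fun e _ => ?_
  rw [← hp, ← AlgHom.coe_toRingHom, map_universal]
  congr 1
  · ext1 q
    simp
  · ext1 i
    simp only [Function.comp, boolInput, x]
    by_cases h1 : (i : ℕ) < u
    · simp [h1]
    · have h2 : ¬ (i : ℕ) < v := by omega
      simp [h1, h2]

/-! ### Size and degree of the coefficients -/

/-- A subadditive and submultiplicative function on a ring with values in `ℕ`. -/
structure IsNatNorm {R : Type*} [CommRing R] (ν : R → ℕ) : Prop where
  map_zero : ν 0 = 0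
  map_one : ν 1 ≤ 1
  add_le : ∀ a b, ν (a + b) ≤ ν a + ν b
  mul_le : ∀ a b, ν (a * b) ≤ ν a * ν b

theorem isNatNorm_natAbs : IsNatNorm Int.natAbs :=
  ⟨rfl, le_rfl, Int.natAbs_add_le, fun a b => (Int.natAbs_mul a b).le⟩

/-- The sum of the norms of the coefficients of a polynomial. -/
def coeffNorm {R σ : Type*} [CommRing R] (ν : R → ℕ) (f : MvPolynomial σ R) : ℕ :=
  ∑ μ ∈ f.support, ν (coeff μ f)

namespace IsNatNorm

variable {R σ ι : Type*} [CommRing R] {ν : R → ℕ}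

theorem sum_le (hν : IsNatNorm ν) (s : Finset ι) (f : ι → R) :
    ν (∑ i ∈ s, f i) ≤ ∑ i ∈ s, ν (f i) := by
  classical
  induction s using Finset.induction_on with
  | empty => simp [hν.map_zero]
  | insert i s hi ih =>
    rw [Finset.sum_insert hi, Finset.sum_insert hi]
    exact (hν.add_le _ _).trans (by omega)

theorem prod_le (hν : IsNatNorm ν) (s : Finset ι) (f : ι → R) :
    ν (∏ i ∈ s, f i) ≤ ∏ i ∈ s, ν (f i) := by
  classical
  induction s using Finset.induction_on with
  | empty => simpa using hν.map_one
  | insert i s hi ih =>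
    rw [Finset.prod_insert hi, Finset.prod_insert hi]
    exact (hν.mul_le _ _).trans (Nat.mul_le_mul_left _ ih)

theorem coeffNorm_eq_sum (hν : IsNatNorm ν) {f : MvPolynomial σ R} {s : Finset (σ →₀ ℕ)}
    (hs : f.support ⊆ s) : coeffNorm ν f = ∑ μ ∈ s, ν (coeff μ f) :=
  Finset.sum_subset hs fun μ _ hμ => by rw [notMem_support_iff.1 hμ, hν.map_zero]

theorem coeffNorm_add_le (hν : IsNatNorm ν) (f g : MvPolynomial σ R) :
    coeffNorm ν (f + g) ≤ coeffNorm ν f + coeffNorm ν g := by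
  classical
  rw [hν.coeffNorm_eq_sum (support_add (p := f) (q := g)),
    hν.coeffNorm_eq_sum (Finset.subset_union_left (s₁ := f.support) (s₂ := g.support)),
    hν.coeffNorm_eq_sum (Finset.subset_union_right (s₁ := f.support) (s₂ := g.support)),
    ← Finset.sum_add_distrib]
  exact Finset.sum_le_sum fun μ _ => by rw [coeff_add]; exact hν.add_le _ _

theorem coeffNorm_monomial_le (hν : IsNatNorm ν) (μ : σ →₀ ℕ) (c : R) :
    coeffNorm ν (monomial μ c) ≤ ν c := by
  classical
  rw [hν.coeffNorm_eq_sum (support_monomial_subset (s := μ) (a := c))]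
  simp

theorem coeffNorm_sum_le (hν : IsNatNorm ν) (s : Finset ι) (f : ι → MvPolynomial σ R) :
    coeffNorm ν (∑ i ∈ s, f i) ≤ ∑ i ∈ s, coeffNorm ν (f i) := by
  classical
  induction s using Finset.induction_on with
  | empty => simp [coeffNorm]
  | insert i s hi ih =>
    rw [Finset.sum_insert hi, Finset.sum_insert hi]
    exact (hν.coeffNorm_add_le _ _).trans (by omega)

theorem coeffNorm_mul_le (hν : IsNatNorm ν) (f g : MvPolynomial σ R) :
    coeffNorm ν (f * g) ≤ coeffNorm ν f * coeffNorm ν g := by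
  classical
  rw [MvPolynomial.mul_def, Finsupp.sum]
  refine (hν.coeffNorm_sum_le _ _).trans ?_
  unfold coeffNorm
  rw [Finset.sum_mul]
  refine Finset.sum_le_sum fun μ _ => ?_
  rw [Finsupp.sum]
  refine (hν.coeffNorm_sum_le _ _).trans ?_
  rw [Finset.mul_sum]
  exact Finset.sum_le_sum fun μ' _ => (hν.coeffNorm_monomial_le _ _).trans (hν.mul_le _ _)

/-- Since the result is again such a norm, the construction can be iterated, first over the
parameters and then over the variables. -/
theorem coeffNorm (hν : IsNatNorm ν) :
    IsNatNorm (coeffNorm ν : MvPolynomial σ R → ℕ) where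
  map_zero := by simp [AlgComplexity.coeffNorm]
  map_one := (hν.coeffNorm_monomial_le 0 1).trans hν.map_one
  add_le := hν.coeffNorm_add_le
  mul_le := hν.coeffNorm_mul_le

theorem coeffNorm_X_le (hν : IsNatNorm ν) (i : σ) :
    AlgComplexity.coeffNorm ν (X i : MvPolynomial σ R) ≤ 1 :=
  (hν.coeffNorm_monomial_le _ 1).trans hν.map_one

theorem coeffNorm_C_le (hν : IsNatNorm ν) (c : R) :
    AlgComplexity.coeffNorm ν (C c : MvPolynomial σ R) ≤ ν c :=
  hν.coeffNorm_monomial_le _ c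

theorem le_coeffNorm (hν : IsNatNorm ν) (f : MvPolynomial σ R) (μ : σ →₀ ℕ) :
    ν (coeff μ f) ≤ AlgComplexity.coeffNorm ν f := by
  by_cases hμ : μ ∈ f.support
  · exact Finset.single_le_sum (f := fun μ => ν (coeff μ f)) (fun _ _ => Nat.zero_le _) hμ
  · rw [notMem_support_iff.1 hμ, hν.map_zero]
    exact Nat.zero_le _

end IsNatNorm

/-- All coefficients of `f` have total degree at most `d`. -/
def CoeffDegreeLE {σ τ R : Type*} [CommRing R] (d : ℕ) (f : MvPolynomial σ (MvPolynomial τ R)) :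
    Prop :=
  ∀ μ, (coeff μ f).totalDegree ≤ d

namespace CoeffDegreeLE

variable {σ τ R ι : Type*} [CommRing R] {d d' : ℕ} {f g : MvPolynomial σ (MvPolynomial τ R)}

theorem monomial {c : MvPolynomial τ R} (hc : c.totalDegree ≤ d) (μ : σ →₀ ℕ) :
    CoeffDegreeLE d (monomial μ c) := by
  classical
  intro μ'
  rw [coeff_monomial]
  split_ifs <;> simp [hc]

theorem sum (s : Finset ι) {f : ι → MvPolynomial σ (MvPolynomial τ R)}
    (hf : ∀ i ∈ s, CoeffDegreeLE d (f i)) : CoeffDegreeLE d (∑ i ∈ s, f i) := by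
  intro μ
  rw [coeff_sum]
  exact totalDegree_finsetSum_le fun i hi => hf i hi μ

theorem mul (hf : CoeffDegreeLE d f) (hg : CoeffDegreeLE d' g) : CoeffDegreeLE (d + d') (f * g) := by
  classical
  intro μ
  rw [coeff_mul]
  exact totalDegree_finsetSum_le fun i _ =>
    (totalDegree_mul _ _).trans (Nat.add_le_add (hf _) (hg _))

end CoeffDegreeLE

section

variable {R : Type*} [CommRing R] {t : ℕ} {v : ℕ}

/-- The degree obeys `d₀ = 0`, `dₙ₊₁ = 2(dₙ + 1)`, solved by `2 ^ (n + 1) - 2`. -/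
theorem layer_coeffDegreeLE (x : Fin t → MvPolynomial (Fin v) (MvPolynomial (Param t) R))
    (hx : ∀ i, CoeffDegreeLE 0 (x i)) (n : ℕ) (i : Node t) :
    CoeffDegreeLE (2 ^ (n + 1) - 2) (layer (fun q => C (X q)) x n i) := by
  induction n generalizing i with
  | zero =>
    rcases i with (_ | i) | i
    · exact CoeffDegreeLE.monomial (by simp) 0
    · exact hx i
    · intro μ
      simp [layer, initialLayer]
  | succ n ih =>
    have h2 : 2 ≤ 2 ^ (n + 1) := by
      rw [pow_succ]; have := Nat.one_le_two_pow (n := n); omega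
    have hlin (b : Bool) : CoeffDegreeLE (1 + (2 ^ (n + 1) - 2))
        (∑ j, C (X (b, i, j)) * layer (fun q => C (X q)) x n j) :=
      CoeffDegreeLE.sum _ fun j _ =>
        (CoeffDegreeLE.monomial (totalDegree_monomial_le _ _ |>.trans (by simp)) 0).mul (ih j)
    have he : 2 ^ (n + 1 + 1) - 2 = 1 + (2 ^ (n + 1) - 2) + (1 + (2 ^ (n + 1) - 2)) := by
      rw [pow_succ 2 (n + 1)]
      omega
    rw [he]
    exact (hlin false).mul (hlin true)

/-- A linear form has `2t + 2` summands, so the bound obeys `N₀ = 1`, `Nₙ₊₁ = ((2t + 2) Nₙ)²`. -/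
theorem coeffNorm_layer_le {ν : R → ℕ} (hν : IsNatNorm ν) (p : Param t → R) (hp : ∀ q, ν (p q) ≤ 1)
    (x : Fin t → R) (hx : ∀ i, ν (x i) ≤ 1) (n : ℕ) (i : Node t) :
    ν (layer p x n i) ≤ (2 * t + 2) ^ (2 ^ (n + 1) - 2) := by
  induction n generalizing i with
  | zero =>
    rcases i with (_ | i) | i
    · exact hν.map_one
    · exact hx i
    · simp [layer, initialLayer, hν.map_zero]
  | succ n ih =>
    have h2 : 2 ≤ 2 ^ (n + 1) := by
      rw [pow_succ]; have := Nat.one_le_two_pow (n := n); omega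
    have hlin (b : Bool) : ν (∑ j, p (b, i, j) * layer p x n j) ≤
        (2 * t + 2) ^ (1 + (2 ^ (n + 1) - 2)) := by
      refine (hν.sum_le _ _).trans ?_
      refine (Finset.sum_le_card_nsmul _ _ ((2 * t + 2) ^ (2 ^ (n + 1) - 2)) fun j _ => ?_).trans ?_
      · refine (hν.mul_le _ _).trans ?_
        simpa using Nat.mul_le_mul (hp (b, i, j)) (ih j)
      · rw [pow_add (2 * t + 2) 1, pow_one, smul_eq_mul]
        refine Nat.mul_le_mul_right _ ?_
        simp only [Finset.card_univ, Fintype.card_sum, Fintype.card_option, Fintype.card_fin]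
        omega
    refine (hν.mul_le _ _).trans ((Nat.mul_le_mul (hlin false) (hlin true)).trans ?_)
    rw [← pow_add]
    refine Nat.pow_le_pow_right (by omega) ?_
    rw [pow_succ 2 (n + 1)]
    omega

end

theorem boolInput_coeffDegreeLE {R τ : Type*} [CommRing R] (v t : ℕ) {u : ℕ}
    (e : Fin (u - v) → Fin 2) (i : Fin t) :
    CoeffDegreeLE 0 (boolInput (MvPolynomial τ R) v t e i) := by
  unfold boolInput
  split_ifs
  · exact CoeffDegreeLE.monomial (by simp) _
  · refine CoeffDegreeLE.monomial ?_ _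
    rw [← map_natCast C, totalDegree_C]
  · intro μ
    simp

theorem coeffNorm_boolInput_le {R : Type*} [CommRing R] {ν : R → ℕ} (hν : IsNatNorm ν) (v t : ℕ)
    {u : ℕ} (e : Fin (u - v) → Fin 2) (i : Fin t) : coeffNorm ν (boolInput R v t e i) ≤ 1 := by
  unfold boolInput
  split_ifs with h h'
  · exact hν.coeffNorm_X_le _
  · refine (hν.coeffNorm_C_le _).trans ?_
    generalize e _ = b
    fin_cases b
    · simp [hν.map_zero]
    · simpa using hν.map_one
  · simp [coeffNorm]

/-! ### Universal coefficients as integer polynomials in the parameters -/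

/-- The coefficients of the universal Boolean sum as polynomials in the parameters. -/
def universalCoeff (v u t : ℕ) (μ : Fin v →₀ ℕ) : MvPolynomial (Param t) ℤ :=
  coeff μ (universalSum v u X)

theorem totalDegree_universalCoeff_le (v u t : ℕ) (μ : Fin v →₀ ℕ) :
    (universalCoeff v u t μ).totalDegree ≤ 2 ^ (t + 2) := by
  refine (CoeffDegreeLE.sum _ (fun e _ => layer_coeffDegreeLE _
    (boolInput_coeffDegreeLE v t e) _ _) μ).trans (Nat.sub_le _ _)

theorem coeffNorm_universalCoeff_le {v u t : ℕ} (hut : u ≤ t) (μ : Fin v →₀ ℕ) :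
    coeffNorm Int.natAbs (universalCoeff v u t μ) ≤ 2 ^ 2 ^ (2 * t + 3) := by
  have h1 : IsNatNorm (coeffNorm Int.natAbs : MvPolynomial (Param t) ℤ → ℕ) :=
    isNatNorm_natAbs.coeffNorm
  have h2 : IsNatNorm (coeffNorm (coeffNorm Int.natAbs) :
    MvPolynomial (Fin v) (MvPolynomial (Param t) ℤ) → ℕ) := h1.coeffNorm
  refine (h1.le_coeffNorm _ μ).trans ((h2.sum_le _ _).trans ?_)
  refine (Finset.sum_le_card_nsmul _ _ ((2 * t + 2) ^ 2 ^ (t + 2)) fun e _ => ?_).trans ?_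
  · refine (coeffNorm_layer_le h2 _ (fun q => ?_) _ (coeffNorm_boolInput_le h1 v t e) _ _).trans
      (Nat.pow_le_pow_right (by omega) (Nat.sub_le _ _))
    exact (h1.coeffNorm_C_le _).trans (isNatNorm_natAbs.coeffNorm_X_le _)
  · have ht : t + 1 ≤ 2 ^ t := Nat.lt_two_pow_self
    simp only [Finset.card_univ, Fintype.card_fun, Fintype.card_fin, smul_eq_mul]
    calc 2 ^ (u - v) * (2 * t + 2) ^ 2 ^ (t + 2)
        ≤ 2 ^ t * (2 ^ (t + 1)) ^ 2 ^ (t + 2) := by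
          refine Nat.mul_le_mul (Nat.pow_le_pow_right (by norm_num) (by omega))
            (Nat.pow_le_pow_left ?_ _)
          rw [pow_succ]; omega
      _ = 2 ^ (t + (t + 1) * 2 ^ (t + 2)) := by rw [← pow_mul, ← pow_add]
      _ ≤ 2 ^ 2 ^ (2 * t + 3) := by
          refine Nat.pow_le_pow_right (by norm_num) ?_
          have e1 : (2 : ℕ) ^ (t + 2) = 2 ^ t * 4 := by rw [pow_add]; norm_num
          have e2 : (2 : ℕ) ^ (2 * t + 3) = 2 ^ t * 2 ^ t * 8 := by
            rw [pow_add, two_mul, pow_add]; norm_num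
          rw [e1, e2]
          nlinarith

/-- The coefficients of a polynomial definable within the bound `t` are values of the universal
coefficients at a common point. -/
theorem exists_aeval_universalCoeff_eq {F : Type*} [Field F] {v t : ℕ} {f : MvPolynomial (Fin v) F}
    (hf : f ∈ definableWithin F v t) :
    ∃ u ≤ t, ∃ p : Param t → F, ∀ μ, aeval p (universalCoeff v u t μ) = coeff μ f := by
  obtain ⟨u, hu, p, rfl⟩ := exists_universalSum_eq hf
  refine ⟨u, hu, p, fun μ => ?_⟩
  have := map_universalSum (aeval (R := ℤ) p).toRingHom v u (X : Param t → MvPolynomial (Param t) ℤ)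
  rw [show ⇑(aeval (R := ℤ) p).toRingHom ∘ (X : Param t → MvPolynomial (Param t) ℤ) = p by
    ext1 q; simp] at this
  rw [← this, coeff_map]
  rfl

/-! ### A multilinear equation with coefficients in `{-1, 0, 1}` -/

/-- Two families of sets of monomials whose generating polynomials agree at the universal
coefficients exist by the pigeonhole principle. -/
theorem exists_ne_sum_prod_universalCoeff_eq {I : Type*} [Fintype I] {v t : ℕ}
    (m : I → Fin v →₀ ℕ)
    (hcard : (2 * (2 ^ Fintype.card I * (2 ^ 2 ^ (2 * t + 3)) ^ Fintype.card I) + 1) ^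
      ((t + 1) * (Fintype.card I * 2 ^ (t + 2) + 1) ^ Fintype.card (Param t)) <
        2 ^ 2 ^ Fintype.card I) :
    ∃ 𝓢 𝓢' : Finset (Finset I), 𝓢 ≠ 𝓢' ∧ ∀ u ≤ t,
      ∑ S ∈ 𝓢, ∏ i ∈ S, universalCoeff v u t (m i) =
        ∑ S ∈ 𝓢', ∏ i ∈ S, universalCoeff v u t (m i) := by
  classical
  set K := Fintype.card I
  set B := 2 ^ 2 ^ (2 * t + 3)
  have hB : 1 ≤ B := Nat.one_le_two_pow
  let Q : Finset (Finset I) → ℕ → MvPolynomial (Param t) ℤ := fun 𝓢 u =>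
    ∑ S ∈ 𝓢, ∏ i ∈ S, universalCoeff v u t (m i)
  have hnorm (𝓢 : Finset (Finset I)) (u : ℕ) (hu : u ≤ t) (e : Param t →₀ ℕ) :
      (coeff e (Q 𝓢 u)).natAbs ≤ 2 ^ K * B ^ K := by
    have h1 : IsNatNorm (coeffNorm Int.natAbs : MvPolynomial (Param t) ℤ → ℕ) :=
      isNatNorm_natAbs.coeffNorm
    refine (isNatNorm_natAbs.le_coeffNorm _ e).trans ((h1.sum_le _ _).trans ?_)
    refine (Finset.sum_le_card_nsmul _ _ (B ^ K) fun S _ => ?_).trans ?_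
    · refine (h1.prod_le _ _).trans ((Finset.prod_le_pow_card _ _ B fun i _ =>
        coeffNorm_universalCoeff_le hu _).trans (Nat.pow_le_pow_right hB S.card_le_univ))
    · rw [smul_eq_mul]
      refine Nat.mul_le_mul_right _ (𝓢.card_le_univ.trans ?_)
      rw [Fintype.card_finset]
  have hdeg (𝓢 : Finset (Finset I)) (u : ℕ) : (Q 𝓢 u).totalDegree ≤ K * 2 ^ (t + 2) := by
    refine totalDegree_finsetSum_le fun S _ => (totalDegree_finsetProd _ _).trans ?_
    refine (Finset.sum_le_card_nsmul _ _ _ fun i _ =>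
      totalDegree_universalCoeff_le v u t (m i)).trans ?_
    rw [smul_eq_mul]
    exact Nat.mul_le_mul_right _ S.card_le_univ
  -- The index `u` is part of the data, so that a single coincidence gives one equation valid for
  -- all `u ≤ t`.
  let D := Fin (t + 1) × (Param t → Fin (K * 2 ^ (t + 2) + 1))
  let ψ : Finset (Finset I) → D → ℤ := fun 𝓢 q =>
    coeff (Finsupp.equivFunOnFinite.symm fun i => (q.2 i : ℕ)) (Q 𝓢 q.1)
  let N : ℕ := 2 ^ K * B ^ K
  have hψ : ∀ 𝓢 ∈ (Finset.univ : Finset (Finset (Finset I))),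
      ψ 𝓢 ∈ Fintype.piFinset fun _ : D => Finset.Icc (-(N : ℤ)) N := by
    intro 𝓢 _
    rw [Fintype.mem_piFinset]
    intro q
    rw [Finset.mem_Icc, ← abs_le, Int.abs_eq_natAbs]
    exact_mod_cast hnorm 𝓢 q.1 (Nat.lt_succ_iff.1 q.1.2) _
  obtain ⟨𝓢, -, 𝓢', -, hne, heq⟩ := Finset.exists_ne_map_eq_of_card_lt_of_maps_to (by
    rw [Finset.card_univ, Fintype.card_finset, Fintype.card_finset, Fintype.card_piFinset]
    simp only [Finset.prod_const, Finset.card_univ, Int.card_Icc, D, Fintype.card_prod,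
      Fintype.card_fun, Fintype.card_fin]
    rw [show ((N : ℤ) + 1 - -(N : ℤ)).toNat = 2 * N + 1 by omega]
    simpa only [Fintype.card_prod] using hcard) hψ
  refine ⟨𝓢, 𝓢', hne, fun u hu => ?_⟩
  change Q 𝓢 u = Q 𝓢' u
  ext e
  by_cases he : ∀ i, e i ≤ K * 2 ^ (t + 2)
  · have := congrFun heq (⟨u, Nat.lt_succ_iff.2 hu⟩, fun i => ⟨e i, Nat.lt_succ_iff.2 (he i)⟩)
    convert this using 2 <;> (ext i; rfl)
  -- Outside the box of recorded exponents both coefficients vanish by the degree bound.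
  · obtain ⟨i, hi⟩ := not_forall.1 he
    have hlt (𝓢 : Finset (Finset I)) : coeff e (Q 𝓢 u) = 0 := by
      by_contra h
      refine hi (le_trans ?_ ((le_totalDegree (mem_support_iff.2 h)).trans (hdeg 𝓢 u)))
      by_cases hi' : i ∈ e.support
      · exact Finset.single_le_sum (f := e) (fun _ _ => Nat.zero_le _) hi'
      · rw [Finsupp.notMem_support_iff.1 hi']
        exact Nat.zero_le _
    rw [hlt, hlt]

/-- An equation satisfied by the universal coefficients holds on the Zariski closure. -/
theorem sum_prod_coeff_eq_of_mem_zariskiClosure {F I : Type*} [Field F] {v t : ℕ}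
    {m : I → Fin v →₀ ℕ} {𝓢 𝓢' : Finset (Finset I)}
    (h : ∀ u ≤ t, ∑ S ∈ 𝓢, ∏ i ∈ S, universalCoeff v u t (m i) =
      ∑ S ∈ 𝓢', ∏ i ∈ S, universalCoeff v u t (m i))
    {f : MvPolynomial (Fin v) F} (hf : f ∈ zariskiClosure (definableWithin F v t)) :
    ∑ S ∈ 𝓢, ∏ i ∈ S, coeff (m i) f = ∑ S ∈ 𝓢', ∏ i ∈ S, coeff (m i) f := by
  have := hf (∑ S ∈ 𝓢, ∏ i ∈ S, X (m i) - ∑ S ∈ 𝓢', ∏ i ∈ S, X (m i)) fun g hg => by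
    obtain ⟨u, hu, p, hp⟩ := exists_aeval_universalCoeff_eq hg
    have := congrArg (aeval p) (h u hu)
    simp only [map_sum, map_prod, hp] at this
    simp [this]
  simpa [sub_eq_zero] using this

/-- The product over `S` is `2 ^ b S` with `b S = ∑ 2 ^ j i`. Binary expansion recovers `S` from `b
S`, and then `𝓢` from `∑ 2 ^ b S`. -/
theorem injective_sum_prod_two_pow_two_pow {I : Type*} {j : I → ℕ} (hj : Function.Injective j) :
    Function.Injective fun 𝓢 : Finset (Finset I) => ∑ S ∈ 𝓢, ∏ i ∈ S, 2 ^ 2 ^ j i := by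
  let b : Finset I ↪ ℕ := ⟨fun S => ∑ i ∈ S, 2 ^ j i, fun S S' h => by
    have := Finset.geomSum_injective (n := 2) le_rfl (a₁ := S.map ⟨j, hj⟩) (a₂ := S'.map ⟨j, hj⟩)
      (by simpa using h)
    exact Finset.map_injective _ this⟩
  intro 𝓢 𝓢' h
  refine Finset.map_injective b (Finset.geomSum_injective (n := 2) le_rfl ?_)
  simp only [Finset.sum_map]
  simp only [Finset.prod_pow_eq_pow_sum] at h
  exact h

/-- After two logarithms the left side is at most `(L + 2t + 5) + (t + (L + t + 3)M) ≤ (M + 1)(L +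
3t + 5)`, the right side is `K`. -/
theorem pow_lt_two_pow_two_pow {K L t M : ℕ} (h : (M + 1) * (L + 3 * t + 5) < K) (hK : K ≤ 2 ^ L) :
    (2 * (2 ^ K * (2 ^ 2 ^ (2 * t + 3)) ^ K) + 1) ^ ((t + 1) * (K * 2 ^ (t + 2) + 1) ^ M) <
      2 ^ 2 ^ K := by
  have h1 : 2 * (2 ^ K * (2 ^ 2 ^ (2 * t + 3)) ^ K) + 1 ≤ 2 ^ 2 ^ (L + 2 * t + 5) := by
    calc 2 * (2 ^ K * (2 ^ 2 ^ (2 * t + 3)) ^ K) + 1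
        = 2 * 2 ^ (K + 2 ^ (2 * t + 3) * K) + 1 := by rw [← pow_mul, ← pow_add]
      _ ≤ 2 ^ (K + 2 ^ (2 * t + 3) * K + 2) := by
          rw [pow_add 2 (K + 2 ^ (2 * t + 3) * K) 2]
          have := Nat.one_le_two_pow (n := K + 2 ^ (2 * t + 3) * K)
          omega
      _ ≤ 2 ^ 2 ^ (L + 2 * t + 5) := by
          refine Nat.pow_le_pow_right (by norm_num) ?_
          have e : 2 ^ (L + 2 * t + 5) = 2 ^ L * (2 ^ (2 * t + 3) * 4) := by
            rw [show L + 2 * t + 5 = L + (2 * t + 3 + 2) by ring, pow_add, pow_add 2 (2 * t + 3)]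
            norm_num
          have := Nat.one_le_two_pow (n := 2 * t + 3)
          have h3 := Nat.mul_le_mul_right (2 ^ (2 * t + 3) * 4) hK
          rw [e]
          nlinarith
  have h2 : K * 2 ^ (t + 2) + 1 ≤ 2 ^ (L + t + 3) := by
    have e : 2 ^ (L + t + 3) = 2 ^ L * 2 ^ (t + 2) * 2 := by rw [← pow_add, ← pow_succ]; ring
    have := Nat.mul_le_mul_right (2 ^ (t + 2)) hK
    have : 1 ≤ 2 ^ L * 2 ^ (t + 2) := Nat.one_le_iff_ne_zero.2 (by positivity)
    omega
  have h3 : (t + 1) * (K * 2 ^ (t + 2) + 1) ^ M ≤ 2 ^ (t + (L + t + 3) * M) := by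
    rw [pow_add 2 t ((L + t + 3) * M), pow_mul]
    exact Nat.mul_le_mul Nat.lt_two_pow_self (Nat.pow_le_pow_left h2 M)
  calc _ ≤ (2 ^ 2 ^ (L + 2 * t + 5)) ^ 2 ^ (t + (L + t + 3) * M) :=
        (Nat.pow_le_pow_left h1 _).trans (Nat.pow_le_pow_right (by positivity) h3)
    _ = 2 ^ 2 ^ (L + 2 * t + 5 + (t + (L + t + 3) * M)) := by rw [← pow_mul, ← pow_add]
    _ < 2 ^ 2 ^ K := by
        refine Nat.pow_lt_pow_right (by norm_num) (Nat.pow_lt_pow_right (by norm_num) ?_)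
        nlinarith [Nat.zero_le (t * M), Nat.zero_le M]

theorem PBounded.exists_lt_pow_log {t : ℕ → ℕ} (ht : PBounded t) :
    ∃ n L, (8 * (t n + 1) ^ 2 + 1) * (L + 3 * t n + 5) < n ^ Nat.log 2 n ∧
      n ^ Nat.log 2 n ≤ 2 ^ L := by
  obtain ⟨c, hc⟩ := ht
  -- For `n = 2 ^ k` one has `n ^ log n = 2 ^ (k * k)`, while the competing product is at most `2 ^
  -- (7 + 4k(c+1))`; here `k * k = 4k(c+1) + 8k`.
  obtain ⟨k, hk⟩ : ∃ k, k = 4 * (c + 1) + 8 := ⟨_, rfl⟩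
  refine ⟨2 ^ k, k * k, ?_⟩
  rw [Nat.log_pow (by norm_num), ← pow_mul]
  refine ⟨?_, le_rfl⟩
  obtain ⟨s, hs⟩ : ∃ s, s = t (2 ^ k) := ⟨_, rfl⟩
  rw [← hs]
  obtain ⟨T, hT⟩ : ∃ T, T = 2 ^ (k * (c + 1)) := ⟨_, rfl⟩
  have hsT : s + 1 ≤ T := by
    have h1 := hc (2 ^ k)
    rw [← pow_mul] at h1
    have h2 : c + 1 ≤ 2 ^ c := Nat.lt_two_pow_self
    have h3 : 2 ^ c ≤ 2 ^ (k * c) := Nat.pow_le_pow_right (by norm_num) (by nlinarith)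
    have h4 : 2 ^ (k * c + 1) ≤ T := by
      rw [hT]
      exact Nat.pow_le_pow_right (by norm_num) (by nlinarith)
    rw [pow_succ] at h4
    omega
  have hkT : k ≤ T := by
    have h1 : k < 2 ^ k := Nat.lt_two_pow_self
    have h2 : 2 ^ k ≤ T := by
      rw [hT]
      exact Nat.pow_le_pow_right (by norm_num) (by nlinarith)
    omega
  have h1 : 8 * (s + 1) ^ 2 + 1 ≤ 2 ^ 4 * T ^ 2 := by nlinarith
  have h2 : k * k + 3 * s + 5 ≤ 2 ^ 3 * T ^ 2 := by nlinarith
  calc _ ≤ 2 ^ 4 * T ^ 2 * (2 ^ 3 * T ^ 2) := Nat.mul_le_mul h1 h2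
    _ = 2 ^ (7 + k * (c + 1) * 4) := by rw [pow_add, pow_mul, ← hT]; ring
    _ < 2 ^ (k * k) := Nat.pow_lt_pow_right (by norm_num) (by nlinarith)

/-- The exponent `j(μ)` reads `μ` as base-`n` digits; writing it through `finFunctionFinEquiv` makes
its injectivity available. -/
theorem coeff_doubleExpFamily (n : ℕ) (μ : Fin (Nat.log 2 n) → Fin n) :
    coeff (Finsupp.equivFunOnFinite.symm fun i => (μ i : ℕ)) (doubleExpFamily.poly n) =
      2 ^ 2 ^ (finFunctionFinEquiv μ : ℕ) := by
  classical
  have hterm (c : ℚ) (μ' : Fin (Nat.log 2 n) → Fin n) :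
      (C c * ∏ i, X i ^ (μ' i : ℕ) : MvPolynomial (Fin (Nat.log 2 n)) ℚ) =
        monomial (Finsupp.equivFunOnFinite.symm fun i => (μ' i : ℕ)) c := by
    rw [monomial_eq, Finsupp.prod_fintype _ _ fun i => pow_zero _]
    rfl
  change coeff _ (∑ μ' : Fin (Nat.log 2 n) → Fin n,
    C ((2 : ℚ) ^ (2 ^ (∑ i, (μ' i : ℕ) * n ^ (i : ℕ)) : ℕ)) * ∏ i, X i ^ (μ' i : ℕ) :
      MvPolynomial (Fin (Nat.log 2 n)) ℚ) = _
  simp_rw [hterm, coeff_sum, coeff_monomial]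
  rw [Finset.sum_eq_single μ, if_pos rfl, finFunctionFinEquiv_apply]
  · intro μ' _ hne
    refine if_neg fun h => hne (funext fun i => Fin.ext ?_)
    exact congrFun (Finsupp.equivFunOnFinite.symm.injective h) i
  · simp

theorem doubleExpFamily_notMem_VNPClosure : doubleExpFamily ∉ VNPClosure ℚ := by
  rintro ⟨-, t, ht, h⟩
  obtain ⟨n, L, hn, hL⟩ := ht.exists_lt_pow_log
  obtain ⟨𝓢, 𝓢', hne, hS⟩ := exists_ne_sum_prod_universalCoeff_eq (t := t n)
    (fun μ : Fin (Nat.log 2 n) → Fin n => Finsupp.equivFunOnFinite.symm fun i => (μ i : ℕ)) (by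
      rw [Fintype.card_fun, Fintype.card_fin, Fintype.card_fin]
      -- The equality to check is the parameter count `2(2t + 2)² = 8(t + 1)²`.
      refine pow_lt_two_pow_two_pow (lt_of_eq_of_lt ?_ hn) hL
      simp only [Fintype.card_prod, Fintype.card_bool, Fintype.card_sum, Fintype.card_option,
        Fintype.card_fin]
      ring)
  have := sum_prod_coeff_eq_of_mem_zariskiClosure hS (h n)
  refine hne (injective_sum_prod_two_pow_two_pow (j := fun μ => (finFunctionFinEquiv μ : ℕ))
    (Fin.val_injective.comp finFunctionFinEquiv.injective) ?_)
  simp only [coeff_doubleExpFamily] at this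
  exact_mod_cast this

end AlgComplexity

end

theorem mainTheorem3 :
    AlgComplexity.doubleExpFamily ∈ AlgComplexity.VQP ℚ ∧
    AlgComplexity.doubleExpFamily ∉ AlgComplexity.VNPClosure ℚ ∧
    ¬ (AlgComplexity.VQP ℚ ⊆ AlgComplexity.VNPClosure ℚ) :=
  ⟨AlgComplexity.doubleExpFamily_mem_VQP, AlgComplexity.doubleExpFamily_notMem_VNPClosure,
    fun h => AlgComplexity.doubleExpFamily_notMem_VNPClosure
      (h AlgComplexity.doubleExpFamily_mem_VQP)⟩
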